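/- Let $N\ge 1$ and let $X_1,\dots,X_N$ be independent random variables, each uniformly distributed on $[0,1]$. Let $X_{(1)}\le\dots\le X_{(N)}$ be the order statistics, put $X_{(0)}=0$ and $X_{(N+1)}=1$, and let $G_i=X_{(i)}-X_{(i-1)}$, $i=1,\dots,N+1$, be the $N+1$ spacings, with increasing rearrangement $G_{(1)}\le\dots\le G_{(N+1)}$. For $1\le k\le N$ let $s_k=\sum_{i=1}^k G_{(i)}$ be the sum of the $k$ smallest spacings. Put $$A(k,N)=\frac{N\,(N+1)!}{(N+1-k)^{k-1}(N+1-k)!},\qquad a(i,k)=\frac{(-1)^{i-1}(k+1-i)^{k-2}}{(k-i)!\,(i-1)!}\quad(1\le i\le k),$$ and $H(x,a,b)=1$ if $a\le x\le b$ and $H(x,a,b)=0$ otherwise (with the convention $0^0=1$). Then the law of $s_k$ is absolutely continuous with respect to Lebesgue measure, and the function $$p_{k,N}(s)=A(k,N)\sum_{i=1}^{k}a(i,k)\left[1-\frac{N+2-i}{k+1-i}\,s\right]^{N-1}H\!\left(s,0,\frac{k+1-i}{N+2-i}\right),\qquad s\in\mathbb R,$$ is nonnegative and is a density of it. Moreover,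 for every $s\ge 0$, $$P(s_k\le s)=A(k,N)\sum_{i=1}^{k}\int_{0}^{\min\left(s,\frac{k+1-i}{N+2-i}\right)}a(i,k)\left[1-\frac{N+2-i}{k+1-i}\,x\right]^{N-1}dx$$ $$=\frac{A(k,N)}{N}\sum_{i=1}^{k}\frac{a(i,k)\,(k+1-i)}{N+2-i}\left(1-\left[1-\frac{N+2-i}{k+1-i}\,s\right]^{N}H\!\left(s,0,\frac{k+1-i}{N+2-i}\right)\right),$$ and $P(s_k\le s)=0$ for $s<0$. -/

import Mathlib

open MeasureTheory ProbabilityTheory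
open scoped Nat

noncomputable section

namespace UniformSpacings

/-- The increasing rearrangement of a finite family of reals: `orderStat x j` is the
`(j+1)`-st smallest of the values of `x`, counted with multiplicity. -/
def orderStat {n : ℕ} (x : Fin n → ℝ) : Fin n → ℝ :=
  x ∘ Tuple.sort x

/-- The extended ordered sample `X_(0) = 0, X_(1), ..., X_(N), X_(N+1) = 1`. -/
def extendedSample {N : ℕ} (x : Fin N → ℝ) : Fin (N + 2) → ℝ :=
  Fin.cons (0 : ℝ) (Fin.snoc (orderStat x) (1 : ℝ) : Fin (N + 1) → ℝ)

/-- The `N + 1` spacings between neighbouring values of the extended ordered sample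
(indexed from `0`). -/
def spacing {N : ℕ} (x : Fin N → ℝ) (i : Fin (N + 1)) : ℝ :=
  extendedSample x i.succ - extendedSample x i.castSucc

/-- `s_k`, the sum of the `k` smallest spacings. -/
def sumSmallest {N : ℕ} (k : ℕ) (x : Fin N → ℝ) : ℝ :=
  ∑ i : Fin (N + 1) with i.val < k, orderStat (spacing x) i

/-- `H x a b` is `1` if `a ≤ x ≤ b` and `0` otherwise. -/
def H (x a b : ℝ) : ℝ :=
  (Set.Icc a b).indicator (fun _ => 1) x

/-- `A(k, N) = N (N+1)! / ((N+1-k)^(k-1) (N+1-k)!)`, used for `1 ≤ k ≤ N`. -/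
def coeffA (k N : ℕ) : ℝ :=
  (N * (N + 1)! : ℝ) / (((N : ℝ) + 1 - k) ^ (k - 1) * (N + 1 - k)!)

/-- `a(i, k) = (-1)^(i-1) (k+1-i)^(k-2) / ((k-i)! (i-1)!)`, used for `1 ≤ i ≤ k`;
the exponent `k - 2` is an integer (it equals `-1` for `k = 1`). -/
def coeffa (i k : ℕ) : ℝ :=
  ((-1) ^ (i - 1) * ((k : ℝ) + 1 - i) ^ ((k : ℤ) - 2)) / ((k - i)! * (i - 1)!)

/-- The claimed density of `s_k`. -/
def density (k N : ℕ) (s : ℝ) : ℝ :=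
  coeffA k N * ∑ i ∈ Finset.Icc 1 k,
    coeffa i k * (1 - (((N : ℝ) + 2 - i) / ((k : ℝ) + 1 - i)) * s) ^ (N - 1) *
      H s 0 (((k : ℝ) + 1 - i) / ((N : ℝ) + 2 - i))

/-- The claimed distribution function of `s_k` on `[0, ∞)`, as a sum of integrals. -/
def cdfIntegral (k N : ℕ) (s : ℝ) : ℝ :=
  coeffA k N * ∑ i ∈ Finset.Icc 1 k,
    ∫ x in (0 : ℝ)..min s (((k : ℝ) + 1 - i) / ((N : ℝ) + 2 - i)),
      coeffa i k * (1 - (((N : ℝ) + 2 - i) / ((k : ℝ) + 1 - i)) * x) ^ (N - 1)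

/-- The claimed distribution function of `s_k` on `[0, ∞)`, in closed form. -/
def cdfClosed (k N : ℕ) (s : ℝ) : ℝ :=
  coeffA k N / N * ∑ i ∈ Finset.Icc 1 k,
    coeffa i k * ((k : ℝ) + 1 - i) / ((N : ℝ) + 2 - i) *
      (1 - (1 - (((N : ℝ) + 2 - i) / ((k : ℝ) + 1 - i)) * s) ^ N *
        H s 0 (((k : ℝ) + 1 - i) / ((N : ℝ) + 2 - i)))

end UniformSpacings

end

namespace UniformSpacings

/-! ### Piecewise affine images of Lebesgue measure -/

/-! The sample is uniform on the cube. Taking the first `N` spacings, and then the normalised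
differences `D_j = (N+1-j)(G_(j+1) - G_(j))`, `0 ≤ j < N`, with `G_(0) = 0`, of the ordered
spacings, are maps that are affine and injective on each cell of a sorting permutation, and each
cell covers the simplex up to a null set. Both therefore carry Lebesgue measure to a constant times
Lebesgue measure on the simplex, so `D` is uniform there (`exists_measure_normalizedDiff_eq_mul`).
The constants are never computed; total mass fixes their product. Abel summation gives `s_k = ∑
(k-j)₊ / (N+1-j) * D_j` (`sumSmallest_eq`), so `P(s_k > s)` is `N!` times the volume of the part of
the simplex beyond a hyperplane. With `M = N - k`, the nonzero weights are the distinct numbers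
`(p+1)/(p+M+2)`, `p < k`, and `M` weights vanish. Slicing off one coordinate at a time yields a
partial fraction formula for that volume (`volume_real_slab_slabWeight`), and evaluating its
coefficients at these nodes gives `A(k,N)` and `a(i,k)` with `i = k - p`. This establishes the
distribution function first. The density is nonnegative because it is the derivative of a monotone
function, and the law is then identified on half-lines. -/

theorem exists_volume_preimage_eq_mul {n : ℕ} (e : (Fin n → ℝ) → Fin n → ℝ)
    (L : (Fin n → ℝ) →ₗ[ℝ] Fin n → ℝ) (b : Fin n → ℝ) (he : ∀ x, e x = L x + b)
    (hinj : Function.Injective e) :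
    ∃ c : ENNReal, ∀ B : Set (Fin n → ℝ), volume (e ⁻¹' B) = c * volume B := by
  have hL : Function.Injective L := fun x y h => hinj (by rw [he, he, h])
  have hdet : LinearMap.det L ≠ 0 := by
    have := LinearEquiv.isUnit_det' (LinearEquiv.ofInjectiveEndo L hL)
    exact this.ne_zero
  refine ⟨ENNReal.ofReal |(LinearMap.det L)⁻¹|, fun B => ?_⟩
  have h1 : e ⁻¹' B = L ⁻¹' ((fun x => x + b) ⁻¹' B) := by
    ext x; simp [he]
  rw [h1, Measure.addHaar_preimage_linearMap _ hdet, measure_preimage_add_right]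

/-- On the cell `τ = i` the map is `e i`, which scales all volumes by one factor. By `hTS`, the part
of `e i ⁻¹' (T ∩ B)` outside that cell of `S` lies in `e i ⁻¹' (T \ T₀)`, which is null. Hence each
cell contributes a multiple of `volume (T ∩ B)`, and the factors add up. -/
theorem exists_volume_inter_preimage_eq_mul {n : ℕ} {ι : Type*} [Fintype ι]
    (S T T₀ : Set (Fin n → ℝ)) (τ : (Fin n → ℝ) → ι)
    (hτ : ∀ i, MeasurableSet (τ ⁻¹' {i}))
    (e : ι → (Fin n → ℝ) → Fin n → ℝ) (f : (Fin n → ℝ) → Fin n → ℝ)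
    (hf : ∀ x, f x = e (τ x) x)
    (haff : ∀ i, ∃ (L : (Fin n → ℝ) →ₗ[ℝ] Fin n → ℝ) (b : Fin n → ℝ), ∀ x, e i x = L x + b)
    (hinj : ∀ i, Function.Injective (e i))
    (hST : ∀ x ∈ S, f x ∈ T)
    (hTS : ∀ i x, e i x ∈ T₀ → x ∈ S ∧ τ x = i)
    (hT : volume (T \ T₀) = 0) :
    ∃ c : ENNReal, ∀ B : Set (Fin n → ℝ), volume (S ∩ f ⁻¹' B) = c * volume (T ∩ B) := by
  have key : ∀ i, ∃ c : ENNReal, ∀ B : Set (Fin n → ℝ),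
      volume ((S ∩ f ⁻¹' B) ∩ τ ⁻¹' {i}) = c * volume (T ∩ B) := by
    intro i
    obtain ⟨L, b, h⟩ := haff i
    obtain ⟨c, hc⟩ := exists_volume_preimage_eq_mul (e i) L b h (hinj i)
    refine ⟨c, fun B => ?_⟩
    rw [← hc]
    apply le_antisymm
    · apply measure_mono
      rintro x ⟨⟨hxS, hxB⟩, hxi⟩
      have hxi : τ x = i := hxi
      have h2 := hST x hxS
      have hxB : f x ∈ B := hxB
      rw [hf, hxi] at h2 hxB
      exact ⟨h2, hxB⟩
    · calc volume (e i ⁻¹' (T ∩ B))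
          ≤ volume (((S ∩ f ⁻¹' B) ∩ τ ⁻¹' {i}) ∪ e i ⁻¹' (T \ T₀)) := by
            apply measure_mono
            rintro x ⟨hxT, hxB⟩
            by_cases h0 : e i x ∈ T₀
            · obtain ⟨h1, h2⟩ := hTS i x h0
              refine Or.inl ⟨⟨h1, ?_⟩, h2⟩
              change f x ∈ B
              rw [hf, h2]
              exact hxB
            · exact Or.inr ⟨hxT, h0⟩
        _ ≤ _ := measure_union_le _ _
        _ = _ := by rw [hc, hT, mul_zero, add_zero]
  choose c hc using key
  refine ⟨∑ i, c i, fun B => ?_⟩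
  have hfin : ∀ A : Set (Fin n → ℝ), volume A = ∑ i, volume (A ∩ τ ⁻¹' {i}) := by
    intro A
    have h := sum_measure_preimage_singleton (μ := volume.restrict A) Finset.univ
      (f := τ) fun i _ => hτ i
    rw [Finset.coe_univ, Set.preimage_univ, Measure.restrict_apply_univ] at h
    rw [← h]
    exact Finset.sum_congr rfl fun i _ => by rw [Measure.restrict_apply (hτ i), Set.inter_comm]
  rw [hfin, Finset.sum_mul]
  exact Finset.sum_congr rfl fun i _ => hc i B

/-! ### Sorting -/

theorem sort_eq_of_strictMono {n : ℕ} (x : Fin n → ℝ) (σ : Equiv.Perm (Fin n))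
    (h : StrictMono (x ∘ σ)) : Tuple.sort x = σ := by
  symm
  rw [Tuple.eq_sort_iff]
  exact ⟨h.monotone, fun i j hij he => absurd he (h hij).ne⟩

theorem measurableSet_sort_preimage {n : ℕ} (σ : Equiv.Perm (Fin n)) :
    MeasurableSet ((Tuple.sort : (Fin n → ℝ) → Equiv.Perm (Fin n)) ⁻¹' {σ}) := by
  have : (Tuple.sort : (Fin n → ℝ) → Equiv.Perm (Fin n)) ⁻¹' {σ} =
      {x | (∀ i j, i ≤ j → x (σ i) ≤ x (σ j)) ∧
        ∀ i j, i < j → x (σ i) = x (σ j) → σ i < σ j} := by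
    ext x
    simp only [Set.mem_preimage, Set.mem_singleton_iff, Set.mem_ofPred_eq, eq_comm (b := σ),
      Tuple.eq_sort_iff]
    rfl
  rw [this]
  simp only [Set.ofPred_and, Set.ofPred_forall]
  refine MeasurableSet.inter ?_ ?_
  · exact .iInter fun i => .iInter fun j => .iInter fun _ =>
      measurableSet_le (measurable_pi_apply _) (measurable_pi_apply _)
  · refine .iInter fun i => .iInter fun j => .iInter fun _ => ?_
    by_cases h : σ i < σ j
    · simp [h]
    · simp only [h, imp_false]
      exact (measurableSet_eq_fun (f := fun x : Fin n → ℝ => x (σ i)) (measurable_pi_apply _)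
        (measurable_pi_apply _)).compl

theorem measurable_orderStat {n : ℕ} :
    Measurable (orderStat : (Fin n → ℝ) → Fin n → ℝ) := by
  refine measurable_pi_lambda _ fun j s hs => ?_
  have : (fun x : Fin n → ℝ => orderStat x j) ⁻¹' s =
      ⋃ σ : Equiv.Perm (Fin n), (Tuple.sort ⁻¹' {σ}) ∩ (fun x : Fin n → ℝ => x (σ j)) ⁻¹' s := by
    ext x
    simp [orderStat]
  rw [this]
  exact .iUnion fun σ => (measurableSet_sort_preimage σ).inter (measurable_pi_apply _ hs)

/-! ### The simplex -/

/-- The solid simplex of nonnegative vectors with coordinate sum at most `1`. -/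
def simplex (n : ℕ) : Set (Fin n → ℝ) := {d | (∀ i, 0 ≤ d i) ∧ ∑ i, d i ≤ 1}

/-- The open simplex. -/
def openSimplex (n : ℕ) : Set (Fin n → ℝ) := {d | (∀ i, 0 < d i) ∧ ∑ i, d i < 1}

theorem volume_simplex_diff_openSimplex (n : ℕ) :
    volume (simplex n \ openSimplex n) = 0 := by
  have hsub : simplex n \ openSimplex n ⊆
      (⋃ i, {d | d i = 0}) ∪ {d | ∑ i, d i = 1} := by
    rintro d ⟨⟨h1, h2⟩, h3⟩
    by_contra hcon
    simp only [Set.mem_union, Set.mem_iUnion, Set.mem_ofPred_eq, not_or, not_exists] at hcon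
    exact h3 ⟨fun i => lt_of_le_of_ne (h1 i) (Ne.symm (hcon.1 i)), lt_of_le_of_ne h2 hcon.2⟩
  refine measure_mono_null hsub (measure_union_null (measure_iUnion_null fun i => ?_) ?_)
  · exact Measure.pi_hyperplane _ i 0
  · let A : AffineSubspace ℝ (Fin n → ℝ) :=
      (AffineSubspace.mk' (1:ℝ) ⊥).comap
        (∑ i, LinearMap.proj i : (Fin n → ℝ) →ₗ[ℝ] ℝ).toAffineMap
    have hA : {d : Fin n → ℝ | ∑ i, d i = 1} = A := by
      ext d
      simp [A, AffineSubspace.mem_mk', sub_eq_zero]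
    rw [hA]
    refine Measure.addHaar_affineSubspace _ _ fun htop => ?_
    have : (0 : Fin n → ℝ) ∈ (A : Set (Fin n → ℝ)) := by rw [htop]; trivial
    rw [← hA] at this
    simp at this

/-! ### Differences -/

theorem sum_sub_castSucc {n : ℕ} (Y : Fin (n + 1) → ℝ) :
    ∑ i : Fin n, (Y i.succ - Y i.castSucc) = Y (Fin.last n) - Y 0 := by
  induction n with
  | zero => simp
  | succ n ih =>
    rw [Fin.sum_univ_castSucc]
    have := ih fun i => Y i.castSucc
    simp only [Fin.castSucc_zero, ← Fin.succ_castSucc] at this ⊢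
    rw [this, ← Fin.succ_last]
    ring

/-- Abel summation. -/
theorem sum_tsub_mul_sub_castSucc {n k : ℕ} (hk : k ≤ n) (Y : Fin (n + 1) → ℝ) (h0 : Y 0 = 0) :
    ∑ j : Fin n, ((k - j : ℕ) : ℝ) * (Y j.succ - Y j.castSucc) =
      ∑ j : Fin n with j.val < k, Y j.succ := by
  -- Passing to sequences on `ℕ` allows an induction on `k` with `n` fixed.
  let Z : ℕ → ℝ := fun j => if h : j < n + 1 then Y ⟨j, h⟩ else 0
  have hs : ∀ j : Fin n, Y j.succ = Z (j + 1) := fun j => by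
    simp only [Z, Nat.succ_lt_succ j.isLt, dif_pos]; rfl
  have hc : ∀ j : Fin n, Y j.castSucc = Z j := fun j => by
    simp only [Z, Nat.lt_succ_of_lt j.isLt, dif_pos]; rfl
  have hZ0 : Z 0 = 0 := by simp [Z]; exact h0
  rw [Finset.sum_filter]
  simp only [hs, hc]
  rw [Fin.sum_univ_eq_sum_range (fun j => ((k - j : ℕ) : ℝ) * (Z (j + 1) - Z j)) n,
    Fin.sum_univ_eq_sum_range (fun j => if j < k then Z (j + 1) else 0) n]
  have h1 : ∀ k, k ≤ n → ∑ j ∈ Finset.range n, ((k - j : ℕ) : ℝ) * (Z (j + 1) - Z j) =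
      ∑ j ∈ Finset.range k, Z (j + 1) := by
    intro k
    induction k with
    | zero => simp
    | succ k ih =>
      intro hk
      rw [Finset.sum_range_succ, ← ih (by omega)]
      -- Raising `k` by one raises the coefficients with `j ≤ k` by one, which adds this telescoping
      -- sum; the other coefficients stay `0` by truncated subtraction.
      have h2 : ∑ j ∈ Finset.range (k + 1), (Z (j + 1) - Z j) = Z (k + 1) := by
        rw [Finset.sum_range_sub, hZ0, sub_zero]
      rw [← h2, ← Finset.sum_subset (Finset.range_mono hk), ← Finset.sum_subset
        (s₂ := Finset.range n) (Finset.range_mono hk), ← Finset.sum_add_distrib]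
      · refine Finset.sum_congr rfl fun j hj => ?_
        have hj : j ≤ k := by simpa [Nat.lt_succ_iff] using hj
        rw [show k + 1 - j = (k - j) + 1 by omega]
        push_cast; ring
      · intro j _ hj
        have hj : k + 1 ≤ j := by simpa using hj
        rw [show k - j = 0 by omega]; simp
      · intro j _ hj
        have hj : k + 1 ≤ j := by simpa using hj
        rw [show k + 1 - j = 0 by omega]; simp
  rw [h1 k hk, ← Finset.sum_filter]
  congr 1
  ext j; simp; omega

/-! ### From the cube to the simplex -/

/-- The successive differences of `y`, starting from `0`. -/
def diff {n : ℕ} (y : Fin n → ℝ) (i : Fin n) : ℝ :=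
  y i - (Fin.cons 0 y : Fin (n + 1) → ℝ) i.castSucc

theorem diff_eq {n : ℕ} (y : Fin n → ℝ) (i : Fin n) :
    diff y i = (Fin.cons 0 y : Fin (n + 1) → ℝ) i.succ -
      (Fin.cons 0 y : Fin (n + 1) → ℝ) i.castSucc := by
  simp [diff]

theorem sum_diff {n : ℕ} (y : Fin n → ℝ) :
    ∑ i, diff y i = (Fin.cons 0 y : Fin (n + 1) → ℝ) (Fin.last n) := by
  simp only [diff_eq]
  rw [sum_sub_castSucc]
  simp

theorem cons_strictMono_of_diff_pos {n : ℕ} (y : Fin n → ℝ) (h : ∀ i, 0 < diff y i) :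
    StrictMono (Fin.cons 0 y : Fin (n + 1) → ℝ) := by
  rw [Fin.strictMono_iff_lt_succ]
  intro i
  have := h i
  rw [diff_eq] at this
  linarith

theorem strictMono_of_diff_pos {n : ℕ} (y : Fin n → ℝ) (h : ∀ i, 0 < diff y i) :
    StrictMono y := fun i j hij => by
  simpa using cons_strictMono_of_diff_pos y h (Fin.succ_lt_succ_iff.2 hij)

theorem pos_of_diff_pos {n : ℕ} (y : Fin n → ℝ) (h : ∀ i, 0 < diff y i) (i : Fin n) :
    0 < y i := by
  simpa using cons_strictMono_of_diff_pos y h (Fin.succ_pos i)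

theorem diff_nonneg {n : ℕ} (y : Fin n → ℝ) (hy : Monotone y) (h0 : ∀ i, 0 ≤ y i) (i : Fin n) :
    0 ≤ diff y i := by
  rcases Fin.eq_zero_or_eq_succ i.castSucc with h | ⟨j, h⟩
  · simpa [diff, h] using h0 i
  · have hji : j ≤ i := by
      have := congrArg Fin.val h
      simp only [Fin.val_castSucc, Fin.val_succ] at this
      exact Fin.le_def.2 (by omega)
    simpa [diff, h] using hy hji

theorem diff_injective {n : ℕ} : Function.Injective (diff : (Fin n → ℝ) → Fin n → ℝ) := by
  intro x y h
  have key : ∀ j : Fin (n + 1), (Fin.cons 0 x : Fin (n + 1) → ℝ) j =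
      (Fin.cons 0 y : Fin (n + 1) → ℝ) j := by
    intro j
    induction j using Fin.induction with
    | zero => simp
    | succ i ih =>
      have := congrFun h i
      rw [diff_eq, diff_eq, ih] at this
      linarith
  funext i
  simpa using key i.succ

/-- `diff` as a linear map. -/
def diffLinear (n : ℕ) : (Fin n → ℝ) →ₗ[ℝ] Fin n → ℝ where
  toFun := diff
  map_add' x y := by
    funext i
    rcases Fin.eq_zero_or_eq_succ i.castSucc with h | ⟨j, h⟩ <;> simp [diff, h]
    ring
  map_smul' c x := by
    funext i
    rcases Fin.eq_zero_or_eq_succ i.castSucc with h | ⟨j, h⟩ <;> simp [diff, h]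
    ring

/-- All spacings but the last. -/
noncomputable def initSpacing {N : ℕ} (x : Fin N → ℝ) (i : Fin N) : ℝ := spacing x i.castSucc

theorem initSpacing_eq {N : ℕ} (x : Fin N → ℝ) : initSpacing x = diff (orderStat x) := by
  funext i
  simp only [initSpacing, spacing, extendedSample, diff_eq]
  rw [Fin.cons_snoc_eq_snoc_cons, Fin.succ_castSucc, Fin.snoc_castSucc, Fin.snoc_castSucc]

theorem sum_spacing {N : ℕ} (x : Fin N → ℝ) : ∑ i, spacing x i = 1 := by
  simp only [spacing]
  rw [sum_sub_castSucc]
  simp only [extendedSample]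
  rw [Fin.cons_zero, ← Fin.succ_last, Fin.cons_succ, Fin.snoc_last, sub_zero]

theorem spacing_eq_snoc {N : ℕ} (x : Fin N → ℝ) :
    spacing x = (Fin.snoc (initSpacing x) (1 - ∑ i, initSpacing x i) : Fin (N + 1) → ℝ) := by
  funext i
  refine Fin.lastCases ?_ (fun i => ?_) i
  · have := sum_spacing x
    rw [Fin.sum_univ_castSucc] at this
    rw [Fin.snoc_last]
    simp only [initSpacing]
    linarith
  · rw [Fin.snoc_castSucc]; rfl

/-- If the differences of `x ∘ σ` lie in the open simplex, then `x ∘ σ` is strictly increasing with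
values in `(0, 1)`; this forces `σ` to be the sorting permutation and `x` to lie in the cube. -/
theorem exists_volume_cube_inter_initSpacing_preimage (N : ℕ) :
    ∃ c : ENNReal, ∀ B : Set (Fin N → ℝ),
      volume ({x : Fin N → ℝ | ∀ i, x i ∈ Set.Icc (0:ℝ) 1} ∩ initSpacing ⁻¹' B) =
        c * volume (simplex N ∩ B) := by
  refine exists_volume_inter_preimage_eq_mul _ _ (openSimplex N) Tuple.sort
    measurableSet_sort_preimage (fun σ x => diff (x ∘ σ)) _ (fun x => initSpacing_eq x) ?_ ?_ ?_ ?_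
    (volume_simplex_diff_openSimplex N)
  · exact fun σ => ⟨diffLinear N ∘ₗ LinearMap.funLeft ℝ ℝ σ, 0, fun x => by
      rw [add_zero]; rfl⟩
  · exact fun σ => diff_injective.comp σ.surjective.injective_comp_right
  · intro x hx
    rw [initSpacing_eq]
    refine ⟨diff_nonneg _ (Tuple.monotone_sort x) fun i => (hx _).1, ?_⟩
    rw [sum_diff]
    rcases Fin.eq_zero_or_eq_succ (Fin.last N) with h | ⟨j, h⟩
    · simp [h]
    · rw [h, Fin.cons_succ]
      exact (hx _).2
  · rintro σ x ⟨h1, h2⟩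
    have hs := strictMono_of_diff_pos _ h1
    refine ⟨fun i => ?_, sort_eq_of_strictMono x σ hs⟩
    obtain ⟨j, rfl⟩ := σ.surjective i
    refine ⟨(pos_of_diff_pos _ h1 j).le, ?_⟩
    rw [sum_diff] at h2
    have := (cons_strictMono_of_diff_pos _ h1).monotone (Fin.le_last j.succ)
    rw [Fin.cons_succ] at this
    exact (this.trans h2.le)

/-! ### Normalised differences of the ordered spacings -/

/-- Barycentric coordinates: the vector completed to total mass `1`. -/
def complete {N : ℕ} (g : Fin N → ℝ) : Fin (N + 1) → ℝ := Fin.snoc g (1 - ∑ i, g i)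

theorem sum_complete {N : ℕ} (g : Fin N → ℝ) : ∑ i, complete g i = 1 := by
  rw [Fin.sum_univ_castSucc]
  simp [complete]

theorem complete_injective {N : ℕ} :
    Function.Injective (complete : (Fin N → ℝ) → Fin (N + 1) → ℝ) := fun g h hgh => by
  funext i
  simpa [complete] using congrFun hgh i.castSucc

theorem measurable_complete {N : ℕ} :
    Measurable (complete : (Fin N → ℝ) → Fin (N + 1) → ℝ) := by
  refine measurable_pi_lambda _ fun i => ?_
  refine Fin.lastCases ?_ (fun i => ?_) i <;> simp only [complete, Fin.snoc_last, Fin.snoc_castSucc]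
  <;> fun_prop

/-- The weighted differences `(n - j) (y_j - y_{j-1})`. -/
noncomputable def weightedDiff {n : ℕ} (y : Fin n → ℝ) (j : Fin n) : ℝ := ((n - j : ℕ) : ℝ) * diff y j

theorem sum_weightedDiff {n : ℕ} (y : Fin n → ℝ) : ∑ j, weightedDiff y j = ∑ j, y j := by
  simp only [weightedDiff, diff_eq]
  rw [sum_tsub_mul_sub_castSucc le_rfl _ (by simp)]
  simp

theorem weight_pos {n : ℕ} (j : Fin n) : (0 : ℝ) < ((n - j : ℕ) : ℝ) := by
  have := j.isLt
  exact_mod_cast (by omega : 0 < n - (j : ℕ))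

theorem weightedDiff_injective {n : ℕ} :
    Function.Injective (weightedDiff : (Fin n → ℝ) → Fin n → ℝ) := fun _ _ h =>
  diff_injective <| funext fun j => mul_left_cancel₀ (weight_pos j).ne' (congrFun h j)

/-- The weighted differences sum to the total of the vector, so the last one is determined by the
total and the others. -/
theorem weightedDiff_init_injOn {N : ℕ} {x y : Fin (N + 1) → ℝ} (hx : ∑ i, x i = ∑ i, y i)
    (h : ∀ j : Fin N, weightedDiff x j.castSucc = weightedDiff y j.castSucc) : x = y := by
  refine weightedDiff_injective (funext fun j => ?_)
  refine Fin.lastCases ?_ h j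
  rw [← sum_weightedDiff x, ← sum_weightedDiff y, Fin.sum_univ_castSucc, Fin.sum_univ_castSucc,
    Finset.sum_congr rfl fun j _ => h j] at hx
  exact add_left_cancel hx

/-- The normalised differences `(N + 1 - j) (G_(j+1) - G_(j))`, `j < N`, of the ordered values
`G_(1) ≤ ... ≤ G_(N+1)` of `complete g`. -/
noncomputable def normalizedDiff {N : ℕ} (g : Fin N → ℝ) (j : Fin N) : ℝ :=
  weightedDiff (orderStat (complete g)) j.castSucc

theorem complete_nonneg {N : ℕ} {g : Fin N → ℝ} (hg : g ∈ simplex N) (i : Fin (N + 1)) :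
    0 ≤ complete g i := by
  refine Fin.lastCases ?_ (fun i => ?_) i
  · simpa [complete] using hg.2
  · simpa [complete] using hg.1 i

theorem sum_orderStat {n : ℕ} (y : Fin n → ℝ) : ∑ i, orderStat y i = ∑ i, y i :=
  Equiv.sum_comp (Tuple.sort y) y

theorem exists_affine_weightedDiff_complete {N : ℕ} (σ : Equiv.Perm (Fin (N + 1))) :
    ∃ (L : (Fin N → ℝ) →ₗ[ℝ] Fin N → ℝ) (b : Fin N → ℝ), ∀ g,
      (fun j : Fin N => weightedDiff (complete g ∘ σ) j.castSucc) = L g + b := by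
  -- `complete` is only affine: `C` is its linear part and `complete 0` its offset.
  let C : (Fin N → ℝ) →ₗ[ℝ] Fin (N + 1) → ℝ :=
    LinearMap.pi fun i => Fin.lastCases (motive := fun _ => (Fin N → ℝ) →ₗ[ℝ] ℝ)
      (-∑ i, LinearMap.proj i) (fun i => LinearMap.proj i) i
  have hC : ∀ g, complete g = C g + complete 0 := fun g => by
    funext i
    refine Fin.lastCases ?_ (fun i => ?_) i <;> simp [C, complete]
    ring
  let D : (Fin (N + 1) → ℝ) →ₗ[ℝ] Fin N → ℝ :=
    LinearMap.pi fun j => (((N + 1 - j.castSucc : ℕ) : ℝ)) •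
      (LinearMap.proj j.castSucc ∘ₗ diffLinear (N + 1))
  have hD : ∀ y, (fun j : Fin N => weightedDiff y j.castSucc) = D y := fun y => by
    funext j
    simp [D, weightedDiff, diffLinear]
  refine ⟨D ∘ₗ LinearMap.funLeft ℝ ℝ σ ∘ₗ C, D (LinearMap.funLeft ℝ ℝ σ (complete 0)), fun g => ?_⟩
  rw [hD, LinearMap.comp_apply, LinearMap.comp_apply, ← map_add, ← map_add, ← hC]
  rfl

/-- The weighted differences of a vector of total mass `1` again have total mass `1`. If the first
`N` lie in the open simplex, the last is positive too, so the permuted vector is positive and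
strictly increasing, which determines the cell. -/
theorem exists_volume_simplex_inter_normalizedDiff_preimage (N : ℕ) :
    ∃ c : ENNReal, ∀ B : Set (Fin N → ℝ),
      volume (simplex N ∩ normalizedDiff ⁻¹' B) = c * volume (simplex N ∩ B) := by
  refine exists_volume_inter_preimage_eq_mul _ _ (openSimplex N)
    (fun g => Tuple.sort (complete g)) (fun σ => ?_)
    (fun σ g j => weightedDiff (complete g ∘ σ) j.castSucc) _ (fun _ => rfl)
    exists_affine_weightedDiff_complete ?_ ?_ ?_ (volume_simplex_diff_openSimplex N)
  · exact measurable_complete (measurableSet_sort_preimage σ)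
  · intro σ g h hgh
    have h1 := weightedDiff_init_injOn (x := complete g ∘ σ) (y := complete h ∘ σ) ?_
      fun j => congrFun hgh j
    · exact complete_injective (σ.surjective.injective_comp_right h1)
    · simp only [Function.comp_apply]
      rw [Equiv.sum_comp σ, Equiv.sum_comp σ, sum_complete, sum_complete]
  · intro g hg
    have h0 : ∀ j, 0 ≤ weightedDiff (orderStat (complete g)) j := fun j =>
      mul_nonneg (weight_pos j).le
        (diff_nonneg _ (Tuple.monotone_sort _) (fun i => complete_nonneg hg _) j)
    refine ⟨fun j => h0 _, ?_⟩
    have h1 := sum_weightedDiff (orderStat (complete g))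
    rw [sum_orderStat, sum_complete, Fin.sum_univ_castSucc] at h1
    have := h0 (Fin.last N)
    simp only [normalizedDiff]
    linarith
  · rintro σ g ⟨h1, h2⟩
    have h3 : ∀ j, 0 < weightedDiff (complete g ∘ σ) j := by
      intro j
      refine Fin.lastCases ?_ h1 j
      have h4 := sum_weightedDiff (complete g ∘ σ)
      simp only [Function.comp_apply] at h4
      rw [Equiv.sum_comp σ (complete g), sum_complete, Fin.sum_univ_castSucc] at h4
      linarith
    have h4 : ∀ j, 0 < diff (complete g ∘ σ) j := fun j =>
      pos_of_mul_pos_right (h3 j) (weight_pos j).le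
    have h5 : ∀ i, 0 < complete g i := fun i => by
      obtain ⟨j, rfl⟩ := σ.surjective i
      exact pos_of_diff_pos _ h4 j
    refine ⟨⟨fun i => ?_, ?_⟩, sort_eq_of_strictMono _ _ (strictMono_of_diff_pos _ h4)⟩
    · simpa [complete] using (h5 i.castSucc).le
    · simpa [complete] using (h5 (Fin.last N)).le

/-! ### The sum of the smallest spacings -/

/-- The weights expressing `s_k` through the normalised differences. -/
noncomputable def weight (k N : ℕ) (j : Fin N) : ℝ := ((k - j : ℕ) : ℝ) / ((N : ℝ) + 1 - j)

theorem sumSmallest_eq {N k : ℕ} (hk : k ≤ N) (x : Fin N → ℝ) :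
    sumSmallest k x = ∑ j, weight k N j * normalizedDiff (initSpacing x) j := by
  have h := sum_tsub_mul_sub_castSucc (hk.trans N.le_succ)
    (Fin.cons 0 (orderStat (spacing x))) (by simp)
  simp only [Fin.cons_succ] at h
  -- Since `k ≤ N`, the last difference has coefficient `0`, so the first `N` suffice.
  rw [sumSmallest, ← h, Fin.sum_univ_castSucc, Fin.val_last, Nat.sub_eq_zero_of_le hk,
    Nat.cast_zero, zero_mul, add_zero]
  refine Finset.sum_congr rfl fun j _ => ?_
  rw [normalizedDiff, weightedDiff, diff_eq, complete, ← spacing_eq_snoc, weight, Fin.val_castSucc,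
    Nat.cast_sub (j.isLt.le.trans N.le_succ)]
  have : (N : ℝ) + 1 - j ≠ 0 := by
    have : (j : ℝ) < N := by exact_mod_cast j.isLt
    linarith
  push_cast
  rw [Fin.cons_succ]
  field_simp

theorem measurable_diff {n : ℕ} : Measurable (diff : (Fin n → ℝ) → Fin n → ℝ) :=
  (diffLinear n).continuous_of_finiteDimensional.measurable

theorem measurable_initSpacing {N : ℕ} :
    Measurable (initSpacing : (Fin N → ℝ) → Fin N → ℝ) := by
  rw [funext initSpacing_eq]
  exact measurable_diff.comp measurable_orderStat

theorem measurable_spacing {N : ℕ} : Measurable (spacing : (Fin N → ℝ) → Fin (N + 1) → ℝ) := by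
  rw [funext spacing_eq_snoc]
  exact measurable_complete.comp measurable_initSpacing

theorem measurable_sumSmallest {N : ℕ} (k : ℕ) : Measurable (sumSmallest k : (Fin N → ℝ) → ℝ) := by
  refine Finset.measurable_sum _ fun i _ => ?_
  exact (measurable_pi_apply i).comp (measurable_orderStat.comp measurable_spacing)

theorem measurable_normalizedDiff {N : ℕ} :
    Measurable (normalizedDiff : (Fin N → ℝ) → Fin N → ℝ) := by
  refine measurable_pi_lambda _ fun j => ?_
  exact ((measurable_pi_apply _).comp (measurable_diff.comp
    (measurable_orderStat.comp measurable_complete))).const_mul _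

/-- The normalised differences of the ordered spacings of a uniform sample are uniformly
distributed on the simplex, up to the normalising constant. -/
theorem exists_measure_normalizedDiff_eq_mul {Ω : Type*} [MeasurableSpace Ω] (P : Measure Ω)
    [IsProbabilityMeasure P] {N : ℕ} (X : Fin N → Ω → ℝ) (hX : ∀ j, Measurable (X j))
    (hunif : ∀ j, pdf.IsUniform (X j) (Set.Icc (0 : ℝ) 1) P volume) (hindep : iIndepFun X P) :
    ∃ c : ENNReal, ∀ B : Set (Fin N → ℝ), MeasurableSet B →
      P {ω | normalizedDiff (initSpacing fun j => X j ω) ∈ B} = c * volume (simplex N ∩ B) := by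
  have hlaw : P.map (fun ω j => X j ω) =
      volume.restrict {x : Fin N → ℝ | ∀ i, x i ∈ Set.Icc (0:ℝ) 1} := by
    rw [(iIndepFun_iff_map_fun_eq_pi_map fun j => (hX j).aemeasurable).1 hindep]
    have h1 : ∀ j, P.map (X j) = volume.restrict (Set.Icc (0:ℝ) 1) := fun j => by
      rw [hunif j, ProbabilityTheory.cond]; simp
    simp only [h1]
    rw [← Measure.restrict_pi_pi, ← volume_pi]
    congr 1
    ext x; simp [Pi.le_def, forall_and]
  obtain ⟨c₁, h₁⟩ := exists_volume_cube_inter_initSpacing_preimage N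
  obtain ⟨c₂, h₂⟩ := exists_volume_simplex_inter_normalizedDiff_preimage N
  refine ⟨c₁ * c₂, fun B hB => ?_⟩
  have hB' := measurable_initSpacing (measurable_normalizedDiff hB)
  rw [mul_assoc, ← h₂, ← h₁, Set.inter_comm, ← Measure.restrict_apply hB', ← hlaw,
    Measure.map_apply (measurable_pi_lambda _ hX) hB']
  rfl

/-! ### Volumes of slabs of the simplex -/

/-- The part of the simplex of size `r` on which `∑ a i * d i > s`. -/
def slab {n : ℕ} (a : Fin n → ℝ) (r s : ℝ) : Set (Fin n → ℝ) :=
  {d | (∀ i, 0 ≤ d i) ∧ ∑ i, d i ≤ r ∧ s < ∑ i, a i * d i}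

theorem slab_eq_empty {n : ℕ} (a : Fin n → ℝ) {r : ℝ} (s : ℝ) (hr : r < 0) :
    slab a r s = ∅ := by
  ext d
  simp only [Set.mem_empty_iff_false, iff_false]
  rintro ⟨h1, h2, -⟩
  have := Finset.sum_nonneg fun i (_ : i ∈ Finset.univ) => h1 i
  linarith

theorem volume_slab_lt_top {n : ℕ} (a : Fin n → ℝ) (r s : ℝ) : volume (slab a r s) < ⊤ := by
  have : slab a r s ⊆ Set.Icc 0 (fun _ => r) := fun d hd =>
    ⟨hd.1, fun i => (Finset.single_le_sum (fun j _ => hd.1 j) (Finset.mem_univ i)).trans hd.2.1⟩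
  exact (measure_mono this).trans_lt isCompact_Icc.measure_lt_top

theorem measurableSet_slab_prod {n : ℕ} (a₀ : ℝ) (a : Fin n → ℝ) (r s : ℝ) :
    MeasurableSet {p : ℝ × (Fin n → ℝ) | 0 ≤ p.1 ∧ p.2 ∈ slab a (r - p.1) (s - a₀ * p.1)} := by
  change MeasurableSet {p : ℝ × (Fin n → ℝ) | 0 ≤ p.1 ∧ (∀ i, 0 ≤ p.2 i) ∧
    ∑ i, p.2 i ≤ r - p.1 ∧ s - a₀ * p.1 < ∑ i, a i * p.2 i}
  simp only [Set.ofPred_and, Set.ofPred_forall]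
  refine .inter (measurableSet_le (by fun_prop) (by fun_prop)) (.inter (.iInter fun i => ?_)
    (.inter ?_ ?_))
  · exact measurableSet_le (by fun_prop) (by fun_prop)
  · exact measurableSet_le (by fun_prop) (by fun_prop)
  · exact measurableSet_lt (by fun_prop) (by fun_prop)

/-- Fubini in the first coordinate `t`: the slice is a slab of size `r - t` with threshold `s - a₀ *
t`. -/
theorem volume_slab_cons {n : ℕ} (a₀ : ℝ) (a : Fin n → ℝ) (r s : ℝ) :
    volume (slab (Fin.cons a₀ a : Fin (n + 1) → ℝ) r s) =
      ∫⁻ t, volume (Prod.mk t ⁻¹'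
        {p : ℝ × (Fin n → ℝ) | 0 ≤ p.1 ∧ p.2 ∈ slab a (r - p.1) (s - a₀ * p.1)}) := by
  rw [← Measure.prod_apply (measurableSet_slab_prod a₀ a r s), ← Measure.volume_eq_prod,
    ← (volume_preserving_piFinSuccAbove (fun _ => ℝ) 0).measure_preimage
      (measurableSet_slab_prod a₀ a r s).nullMeasurableSet]
  congr 1
  ext d
  simp only [slab, Set.mem_ofPred_eq, Set.mem_preimage, MeasurableEquiv.piFinSuccAbove_apply,
    Fin.forall_fin_succ, Fin.sum_univ_succ, Fin.cons_zero, Fin.cons_succ, Fin.insertNthEquiv,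
    Equiv.coe_fn_symm_mk, Fin.removeNth, Fin.zero_succAbove]
  constructor
  · rintro ⟨⟨h1, h2⟩, h3, h4⟩
    exact ⟨h1, h2, by linarith, by linarith⟩
  · rintro ⟨h1, h2, h3, h4⟩
    exact ⟨⟨h1, h2⟩, by linarith, by linarith⟩

theorem volume_real_slab_cons {n : ℕ} (a₀ : ℝ) (a : Fin n → ℝ) {r : ℝ} (hr : 0 ≤ r) (s : ℝ) :
    IntervalIntegrable (fun t => volume.real (slab a (r - t) (s - a₀ * t))) volume 0 r ∧
    volume.real (slab (Fin.cons a₀ a : Fin (n + 1) → ℝ) r s) =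
      ∫ t in (0:ℝ)..r, volume.real (slab a (r - t) (s - a₀ * t)) := by
  set F : ℝ → ENNReal := fun t => volume (Prod.mk t ⁻¹'
        {p : ℝ × (Fin n → ℝ) | 0 ≤ p.1 ∧ p.2 ∈ slab a (r - p.1) (s - a₀ * p.1)}) with hF
  have hmeas : Measurable F := measurable_measure_prodMk_left (measurableSet_slab_prod a₀ a r s)
  have hpos : ∀ t, 0 ≤ t → F t = volume (slab a (r - t) (s - a₀ * t)) := fun t ht => by
    simp only [hF]; congr 1; ext d; simp [ht]
  have hneg : ∀ t, t < 0 → F t = 0 := fun t ht => by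
    have : Prod.mk t ⁻¹'
        {p : ℝ × (Fin n → ℝ) | 0 ≤ p.1 ∧ p.2 ∈ slab a (r - p.1) (s - a₀ * p.1)} = ∅ := by
      ext d; simp [ht.not_ge]
    simp only [hF]; rw [this, measure_empty]
  have hlt : ∀ t, F t < ⊤ := fun t => by
    rcases lt_or_ge t 0 with h | h
    · rw [hneg t h]; simp
    · rw [hpos t h]; exact volume_slab_lt_top _ _ _
  have hzero : ∀ t, t ∉ Set.Icc 0 r → (F t).toReal = 0 := fun t ht => by
    rcases lt_or_ge t 0 with h | h
    · rw [hneg t h]; simp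
    · rw [hpos t h, slab_eq_empty _ _ (by
        have : ¬ t ≤ r := fun h' => ht ⟨h, h'⟩
        linarith), measure_empty]; simp
  have hV := volume_slab_cons a₀ a r s
  have hint : Integrable (fun t => (F t).toReal) := by
    refine integrable_toReal_of_lintegral_ne_top hmeas.aemeasurable ?_
    rw [← hV]
    exact (volume_slab_lt_top _ _ _).ne
  have heq : ∀ t ∈ Set.uIcc 0 r, (F t).toReal =
      volume.real (slab a (r - t) (s - a₀ * t)) := fun t ht => by
    rw [Set.uIcc_of_le hr] at ht
    rw [hpos t ht.1]; rfl
  refine ⟨(hint.intervalIntegrable (a := 0) (b := r)).congr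
    fun t ht => heq t (Set.uIoc_subset_uIcc ht), ?_⟩
  rw [← intervalIntegral.integral_congr heq, intervalIntegral.integral_of_le hr,
    ← integral_Icc_eq_integral_Ioc, setIntegral_eq_integral_of_forall_compl_eq_zero hzero,
    integral_toReal hmeas.aemeasurable (Filter.Eventually.of_forall hlt), ← hV]
  rfl

/-- With nonnegative weights a negative threshold cuts nothing off, so this is the volume of the
whole simplex of size `r`; slicing keeps the threshold negative. -/
theorem volume_real_slab_of_neg {n : ℕ} (a : Fin n → ℝ) (ha : ∀ i, 0 ≤ a i) {r s : ℝ}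
    (hr : 0 ≤ r) (hs : s < 0) : volume.real (slab a r s) = r ^ n / n ! := by
  induction n generalizing r s with
  | zero =>
    have : slab a r s = Set.univ := by
      ext d; simp [slab, hr, hs]
    rw [this]; simp [measureReal_def, volume_pi]
  | succ n ih =>
    rw [← Fin.cons_self_tail a, (volume_real_slab_cons _ _ hr s).2]
    have h1 : ∀ t ∈ Set.uIcc 0 r, volume.real (slab (Fin.tail a) (r - t) (s - a 0 * t)) =
        (r - t) ^ n / n ! := fun t ht => by
      rw [Set.uIcc_of_le hr] at ht
      exact ih _ (fun i => ha i.succ) (by linarith [ht.2])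
        (by nlinarith [mul_nonneg (ha 0) ht.1])
    rw [intervalIntegral.integral_congr h1, intervalIntegral.integral_div,
      intervalIntegral.integral_comp_sub_left (fun x => x ^ n), integral_pow]
    simp [Nat.factorial_succ]
    field_simp

theorem integral_max_affine_pow (α : ℝ) {β a b : ℝ} (hβ : 0 < β) (hab : a ≤ b) {n : ℕ}
    (hn : n ≠ 0) :
    ∫ t in a..b, (max (α + β * t) 0) ^ n =
      ((max (α + β * b) 0) ^ (n + 1) - (max (α + β * a) 0) ^ (n + 1)) / (β * (n + 1)) := by
  have hcont : Continuous fun t : ℝ => (max (α + β * t) 0) ^ n := by fun_prop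
  rw [intervalIntegral.integral_eq_sub_of_hasDeriv_right_of_le hab
    (f := fun t => (max (α + β * t) 0) ^ (n + 1) / (β * (n + 1))) (by fun_prop) ?_
    (hcont.intervalIntegrable _ _)]
  · ring
  · intro t _
    -- A right derivative is enough, and since `β > 0` the kink joins the nonnegative case.
    rcases le_or_gt 0 (α + β * t) with h | h
    · have h1 : HasDerivAt (fun t : ℝ => (α + β * t) ^ (n + 1) / (β * (n + 1)))
          ((α + β * t) ^ n) t := by
        have h2 : HasDerivAt (fun t : ℝ => α + β * t) β t := by
          simpa using ((hasDerivAt_id t).const_mul β).const_add α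
        refine ((h2.pow (n + 1)).div_const (β * (n + 1))).congr_deriv ?_
        have : (n : ℝ) + 1 ≠ 0 := by positivity
        simp only [Nat.add_sub_cancel]
        push_cast
        field_simp
      rw [max_eq_left h]
      refine h1.hasDerivWithinAt.congr (fun u hu => ?_) (by rw [max_eq_left h])
      have : t < u := hu
      rw [max_eq_left (by nlinarith)]
    · rw [max_eq_right h.le, zero_pow hn]
      refine HasDerivAt.hasDerivWithinAt ?_
      refine (hasDerivAt_const t (0:ℝ)).congr_of_eventuallyEq ?_
      have : ∀ᶠ u in nhds t, α + β * u < 0 :=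
        (by fun_prop : Continuous fun u => α + β * u).continuousAt.eventually_lt_const h
      filter_upwards [this] with u hu
      rw [max_eq_right hu.le, zero_pow n.succ_ne_zero, zero_div]

/-- Partial fraction coefficients at the nodes `c 0, ..., c (k - 1)` and an `(M + 1)`-fold node at
`0`. -/
noncomputable def nodeCoeff (c : ℕ → ℝ) (M k p : ℕ) : ℝ :=
  1 / (c p ^ (M + 1) * ∏ q ∈ (Finset.range k).erase p, (c p - c q))

theorem nodeCoeff_succ (c : ℕ → ℝ) (M : ℕ) {k p : ℕ} (hp : p < k) :
    nodeCoeff c M (k + 1) p = nodeCoeff c M k p / (c p - c k) := by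
  have h : (Finset.range (k + 1)).erase p = insert k ((Finset.range k).erase p) := by
    ext j; simp; omega
  rw [nodeCoeff, nodeCoeff, h, Finset.prod_insert (by simp)]
  rw [div_div]
  congr 1
  ring

/-- After cancelling `c p ^ (M + 1)`, the sum is Lagrange's expression for the leading coefficient
of `X ^ k` from its values at the `k + 1` nodes. -/
theorem sum_nodeCoeff_mul_pow {c : ℕ → ℝ} (hc : StrictMono c) (hpos : ∀ p, 0 < c p) (M k : ℕ) :
    ∑ p ∈ Finset.range (k + 1), nodeCoeff c M (k + 1) p * c p ^ (M + k + 1) = 1 := by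
  have h := Lagrange.coeff_eq_sum (s := Finset.range (k + 1)) (v := c) hc.injective.injOn
    (P := Polynomial.X ^ k) (by
      rw [Polynomial.degree_X_pow, Finset.card_range]
      exact_mod_cast Nat.lt_succ_self k)
  rw [Finset.card_range, Nat.add_sub_cancel, Polynomial.coeff_X_pow_self] at h
  rw [h]
  refine Finset.sum_congr rfl fun p hp => ?_
  rw [nodeCoeff, Polynomial.eval_pow, Polynomial.eval_X]
  have h1 := (hpos p).ne'
  have h2 : ∏ q ∈ (Finset.range (k + 1)).erase p, (c p - c q) ≠ 0 := by
    refine Finset.prod_ne_zero_iff.2 fun q hq => sub_ne_zero.2 fun h => ?_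
    exact (Finset.mem_erase.1 hq).1 (hc.injective h).symm
  field_simp
  ring

/-- The weights `c (k - 1), ..., c 0, 0, ..., 0`. -/
def slabWeight (c : ℕ → ℝ) (M : ℕ) : (k : ℕ) → Fin (M + k) → ℝ
  | 0 => 0
  | k + 1 => (Fin.cons (c k) (slabWeight c M k) : Fin (M + k + 1) → ℝ)

theorem slabWeight_nonneg {c : ℕ → ℝ} (hpos : ∀ p, 0 < c p) (M k : ℕ) (i : Fin (M + k)) :
    0 ≤ slabWeight c M k i := by
  induction k with
  | zero => simp [slabWeight]
  | succ k ih =>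
    refine Fin.cases (motive := fun i : Fin (M + k + 1) => 0 ≤ slabWeight c M (k + 1) i)
      ?_ (fun i => ?_) i
    · exact (hpos k).le
    · exact ih i

/-- Induction on `k`, slicing off the coordinate of largest weight `c k`, so that all slopes `c k -
c p` are positive. The lower endpoint of the integral produces the terms `p < k`; everything else is
a multiple of one power, whose coefficient `sum_nodeCoeff_mul_pow` identifies as that of the new
node. -/
theorem volume_real_slab_slabWeight {c : ℕ → ℝ} (hc : StrictMono c) (hpos : ∀ p, 0 < c p) (M k : ℕ)
    {r s : ℝ} (hr : 0 ≤ r) (hs : 0 ≤ s) :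
    volume.real (slab (slabWeight c M k) r s) =
      ∑ p ∈ Finset.range k, nodeCoeff c M k p * (max (c p * r - s) 0) ^ (M + k) / (M + k)! := by
  induction k generalizing r s with
  | zero =>
    have : slab (slabWeight c M 0) r s = ∅ := by
      ext d
      simp only [slab, slabWeight, Pi.zero_apply, zero_mul, Finset.sum_const_zero,
        Set.mem_empty_iff_false, iff_false]
      exact fun h => h.2.2.not_ge hs
    rw [this]; simp
  | succ k ih =>
    obtain ⟨hint, hV⟩ := volume_real_slab_cons (c k) (slabWeight c M k) hr s
    have hck := hpos k
    -- The threshold `s - c k * t` changes sign at `s / c k`: up to `u` the induction hypothesis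
    -- applies, and beyond `u` the slice is a full simplex.
    set u := min r (s / c k) with hu
    have hu0 : 0 ≤ u := le_min hr (by positivity)
    have hur : u ≤ r := min_le_left _ _
    have hus : c k * u ≤ s := by
      have := min_le_right r (s / c k)
      rw [← hu, le_div_iff₀ hck] at this
      linarith
    have hB : max (c k * r - s) 0 = c k * (r - u) := by
      rw [hu]
      rcases le_total r (s / c k) with h | h
      · rw [min_eq_left h]
        rw [le_div_iff₀ hck] at h
        rw [max_eq_right (by linarith)]; ring
      · rw [min_eq_right h]
        have h' := h
        rw [div_le_iff₀ hck] at h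
        rw [max_eq_left (by linarith)]; field_simp
    set B := max (c k * r - s) 0
    have hru : r - u = B / c k := by rw [hB]; field_simp
    have hsu : max (c k * r - s) 0 = c k * r - s ∨ u = r := by
      rcases le_total r (s / c k) with h | h
      · exact Or.inr (min_eq_left h)
      · rw [div_le_iff₀ hck] at h
        exact Or.inl (max_eq_left (by linarith))
    have h1 : ∀ t ∈ Set.uIcc 0 u, volume.real (slab (slabWeight c M k) (r - t) (s - c k * t)) =
        ∑ p ∈ Finset.range k, nodeCoeff c M k p / (M + k)! *
          (max ((c p * r - s) + (c k - c p) * t) 0) ^ (M + k) := fun t ht => by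
      rw [Set.uIcc_of_le hu0] at ht
      rw [ih (by linarith [ht.2]) (by nlinarith [ht.2])]
      refine Finset.sum_congr rfl fun p _ => ?_
      rw [show c p * (r - t) - (s - c k * t) = (c p * r - s) + (c k - c p) * t by ring]
      ring
    have h2 : ∀ t ∈ Set.Ioc u r, volume.real (slab (slabWeight c M k) (r - t) (s - c k * t)) =
        (r - t) ^ (M + k) / (M + k)! := fun t ht => by
      refine volume_real_slab_of_neg _ (slabWeight_nonneg hpos M k) (by linarith [ht.2]) ?_
      have : u ≠ r := (ht.1.trans_le ht.2).ne
      have h3 := hsu.resolve_right this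
      have h4 : c k * (r - u) = c k * r - s := by rw [← hB]; exact h3
      nlinarith [ht.1]
    have i1 : ∫ t in (0:ℝ)..u, volume.real (slab (slabWeight c M k) (r - t) (s - c k * t)) =
        ∑ p ∈ Finset.range k, nodeCoeff c M k p / (M + k)! *
          ((((c p / c k) * B) ^ (M + k + 1) - (max (c p * r - s) 0) ^ (M + k + 1)) /
            ((c k - c p) * ((M + k : ℕ) + 1))) := by
      rw [intervalIntegral.integral_congr h1, intervalIntegral.integral_finsetSum]
      · refine Finset.sum_congr rfl fun p hp => ?_
        have hpk : p < k := Finset.mem_range.1 hp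
        rw [intervalIntegral.integral_const_mul,
          integral_max_affine_pow _ (sub_pos.2 (hc hpk)) hu0 (by omega)]
        -- If the sign change occurs within `[0, r]`, then `s = c k * u`; otherwise `u = r` and both
        -- sides vanish.
        have h5 : max (c p * r - s + (c k - c p) * u) 0 = c p / c k * B := by
          rcases hsu with h | h
          · have h4 : c k * (r - u) = c k * r - s := by rw [← hB]; exact h
            have h6 : c p * r - s + (c k - c p) * u = c p * (r - u) := by linarith
            rw [h6, hru, max_eq_left]
            · ring
            · have := hpos p
              have : 0 ≤ B := le_max_right _ _
              positivity
          · have hB0 : B = 0 := by rw [hB, h]; ring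
            rw [hB0, mul_zero, max_eq_right]
            rw [h] at hus ⊢
            linarith
        rw [h5, mul_zero, add_zero]
      · intro p _
        exact Continuous.intervalIntegrable (by fun_prop) _ _
    have i2 : ∫ t in u..r, volume.real (slab (slabWeight c M k) (r - t) (s - c k * t)) =
        (B / c k) ^ (M + k + 1) / (M + k + 1)! := by
      rw [intervalIntegral.integral_congr_ae (Filter.Eventually.of_forall fun t ht =>
        h2 t (by rwa [Set.uIoc_of_le hur] at ht)), intervalIntegral.integral_div,
        intervalIntegral.integral_comp_sub_left (fun x => x ^ (M + k)), integral_pow, hru]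
      rw [sub_self, zero_pow (by omega), Nat.factorial_succ]
      push_cast
      field_simp
      ring
    have hsplit := intervalIntegral.integral_add_adjacent_intervals
      (hint.mono_set (by
        rw [Set.uIcc_of_le hu0, Set.uIcc_of_le hr]; exact Set.Icc_subset_Icc_right hur))
      (hint.mono_set (by
        rw [Set.uIcc_of_le hur, Set.uIcc_of_le hr]; exact Set.Icc_subset_Icc_left hu0))
    change volume.real (slab (Fin.cons (c k) (slabWeight c M k) : Fin (M + k + 1) → ℝ) r s) = _
    rw [hV, ← hsplit, i1, i2]
    have hone := sum_nodeCoeff_mul_pow hc hpos M k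
    rw [Finset.sum_range_succ] at hone ⊢
    rw [show max (c k * r - s) 0 = B from rfl]
    -- The powers of `B` from the upper endpoint and from the full simplices combine to exactly this
    -- coefficient.
    have hk : nodeCoeff c M (k + 1) k =
        (1 - ∑ p ∈ Finset.range k, nodeCoeff c M (k + 1) p * c p ^ (M + k + 1)) /
          c k ^ (M + k + 1) := by
      rw [eq_div_iff (by positivity), ← hone]; ring
    rw [hk, sub_div, sub_mul, sub_div, Finset.sum_div, Finset.sum_mul, Finset.sum_div,
      add_sub_assoc', add_sub_right_comm, ← Finset.sum_sub_distrib]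
    congr 1
    · refine Finset.sum_congr rfl fun p hp => ?_
      have hpk : p < k := Finset.mem_range.1 hp
      rw [nodeCoeff_succ c M hpk]
      have h7 : c p - c k ≠ 0 := (sub_neg.2 (hc hpk)).ne
      have h8 : c k - c p ≠ 0 := (sub_pos.2 (hc hpk)).ne'
      have h9 : c k - c p = -(c p - c k) := by ring
      rw [← Nat.add_assoc, Nat.factorial_succ, h9, mul_pow, div_pow]
      push_cast
      field_simp
      ring
    · rw [← Nat.add_assoc, div_pow]
      field_simp

/-! ### The nodes of the spacing problem -/

/-- The endpoints `(p + 1) / (p + M + 2)`, where `M = N - k`. -/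
noncomputable def node (M p : ℕ) : ℝ := ((p : ℝ) + 1) / (p + M + 2)

theorem node_pos (M p : ℕ) : 0 < node M p := by unfold node; positivity

theorem node_strictMono (M : ℕ) : StrictMono (node M) := by
  refine strictMono_nat_of_lt_succ fun p => ?_
  rw [node, node, div_lt_div_iff₀ (by positivity) (by positivity)]
  push_cast
  nlinarith [(Nat.cast_nonneg M : (0:ℝ) ≤ M)]

/-- Shifting `j` and lowering `k` by one leaves `k - j` and `M + k + 1 - j` unchanged, so both sides
obey the same recursion. -/
theorem weight_eq_slabWeight (M k : ℕ) : weight k (M + k) = slabWeight (node M) M k := by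
  induction k with
  | zero => funext j; simp [weight, slabWeight]
  | succ k ih =>
    funext j
    change weight (k + 1) (M + k + 1) j =
      (Fin.cons (node M k) (slabWeight (node M) M k) : Fin (M + k + 1) → ℝ) j
    refine Fin.cases ?_ (fun j => ?_) j
    · rw [Fin.cons_zero]
      simp only [weight, node, Fin.val_zero]
      push_cast
      ring_nf
    · rw [Fin.cons_succ, ← ih]
      simp only [weight, Fin.val_succ, Nat.add_sub_add_right]
      push_cast
      ring_nf

/-- The factors with `q < p` give `p!`; those with `q > p` give the sign and the other factorial. -/
theorem prod_erase_sub (k p : ℕ) (hp : p < k) :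
    ∏ q ∈ (Finset.range k).erase p, ((p : ℝ) - q) = (-1) ^ (k - 1 - p) * p ! * (k - 1 - p)! := by
  induction k, hp using Nat.le_induction with
  | base =>
    rw [Finset.range_add_one, Finset.erase_insert (by simp), ← Finset.prod_range_reflect]
    simp only [Nat.succ_eq_add_one, Nat.add_sub_cancel, Nat.sub_self, pow_zero, one_mul,
      Nat.factorial_zero, Nat.cast_one, mul_one]
    rw [← Finset.prod_range_add_one_eq_factorial]
    push_cast
    refine Finset.prod_congr rfl fun j hj => ?_
    have hj : j < p := Finset.mem_range.1 hj
    rw [Nat.sub_sub, Nat.cast_sub (by omega)]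
    push_cast; ring
  | succ k hk ih =>
    have hk : p < k := hk
    rw [Finset.range_add_one, Finset.erase_insert_of_ne hk.ne', Finset.prod_insert (by simp), ih,
      show k + 1 - 1 - p = (k - 1 - p) + 1 by omega, Nat.factorial_succ, pow_succ]
    have : ((k - 1 - p : ℕ) : ℝ) = k - 1 - p := by
      rw [Nat.cast_sub (by omega), Nat.cast_sub (by omega)]; simp
    push_cast
    rw [this]
    ring

theorem prod_range_add_mul_factorial (M k : ℕ) :
    (∏ q ∈ Finset.range k, ((q : ℝ) + M + 2)) * (M + 1)! = (M + k + 1)! := by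
  induction k with
  | zero => simp
  | succ k ih =>
    rw [Finset.prod_range_succ, mul_right_comm, ih, ← Nat.add_assoc, Nat.factorial_succ (M + k + 1)]
    push_cast; ring

/-- Node differences factor as `(M+1)(p-q) / ((p+M+2)(q+M+2))`, so the product over `q` reduces to
factorials and powers. -/
theorem nodeCoeff_node_mul_pow {M k p : ℕ} (hp : p < k) :
    nodeCoeff (node M) M k p * node M p ^ (M + k) =
      (M + k + 1)! * (-1) ^ (k - 1 - p) * (p + 1 : ℝ) ^ (k - 1) /
        ((M + 1)! * (M + 1 : ℝ) ^ (k - 1) * (p + M + 2) * p ! * (k - 1 - p)!) := by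
  obtain ⟨K, rfl⟩ : ∃ K, k = K + 1 := ⟨k - 1, by omega⟩
  have hterm : ∀ q, node M p - node M q =
      (((M : ℝ) + 1) / (p + M + 2)) * ((p : ℝ) - q) / ((q : ℝ) + M + 2) := fun q => by
    unfold node
    have h1 : (p : ℝ) + M + 2 ≠ 0 := by positivity
    have h2 : (q : ℝ) + M + 2 ≠ 0 := by positivity
    field_simp
    ring
  have hcard : ((Finset.range (K + 1)).erase p).card = K := by
    rw [Finset.card_erase_of_mem (Finset.mem_range.2 hp), Finset.card_range]; rfl
  have hB := prod_range_add_mul_factorial M (K + 1)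
  rw [← Finset.mul_prod_erase _ _ (Finset.mem_range.2 hp)] at hB
  have hBpos : 0 < ∏ q ∈ (Finset.range (K + 1)).erase p, ((q : ℝ) + M + 2) :=
    Finset.prod_pos fun q _ => by positivity
  rw [nodeCoeff]
  simp only [hterm]
  rw [Finset.prod_div_distrib, Finset.prod_mul_distrib, Finset.prod_const, hcard,
    prod_erase_sub _ _ hp, ← hB]
  simp only [Nat.add_sub_cancel]
  set Q := ∏ q ∈ (Finset.range (K + 1)).erase p, ((q : ℝ) + M + 2)
  have hsign : ((-1 : ℝ) ^ (K - p)) * (-1) ^ (K - p) = 1 := by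
    rw [← mul_pow]; simp
  have hs0 : ((-1 : ℝ) ^ (K - p)) ≠ 0 := by positivity
  have h1 : (p : ℝ) + M + 2 ≠ 0 := by positivity
  have h2 : (p : ℝ) + 1 ≠ 0 := by positivity
  have h3 : (M : ℝ) + 1 ≠ 0 := by positivity
  have h4 : (p ! : ℝ) ≠ 0 := by positivity
  have h5 : ((K - p)! : ℝ) ≠ 0 := by positivity
  have h6 : ((M + 1)! : ℝ) ≠ 0 := by positivity
  have hQ := hBpos.ne'
  unfold node
  rw [show M + (K + 1) = (M + 1) + K by ring]
  simp only [div_pow, pow_add]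
  field_simp
  rw [pow_two, hsign]

theorem coeff_eq_nodeCoeff {M k p : ℕ} (hp : p < k) :
    coeffA k (M + k) / ((M + k : ℕ) : ℝ) * coeffa (k - p) k * node M p =
      nodeCoeff (node M) M k p * node M p ^ (M + k) := by
  have hN : ((M + k : ℕ) : ℝ) ≠ 0 := by
    have : M + k ≠ 0 := by omega
    exact_mod_cast this
  have h1 : (k : ℝ) + 1 - ((k - p : ℕ) : ℝ) = p + 1 := by
    rw [Nat.cast_sub hp.le]; ring
  have h2 : ((M + k : ℕ) : ℝ) + 1 - k = M + 1 := by push_cast; ring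
  have h3 : M + k + 1 - k = M + 1 := by omega
  have h4 : k - (k - p) = p := by omega
  have h5 : k - p - 1 = k - 1 - p := by omega
  have h6 : (p : ℝ) + 1 ≠ 0 := by positivity
  -- The numerator of `node M p` turns the integer exponent `k - 2` into a natural one, also for `k
  -- = 1`.
  have h7 : ((p : ℝ) + 1) ^ ((k : ℤ) - 2) * ((p : ℝ) + 1) = ((p : ℝ) + 1) ^ (k - 1) := by
    rw [← zpow_natCast, ← zpow_add_one₀ h6]
    congr 1
    rw [Nat.cast_sub (by omega)]
    ring
  rw [nodeCoeff_node_mul_pow hp, coeffA, coeffa, h1, h2, h3, h4, h5, ← h7, node]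
  have h8 : (p : ℝ) + M + 2 ≠ 0 := by positivity
  field_simp

theorem endpoint_eq {M k p : ℕ} (hp : p < k) :
    ((k : ℝ) + 1 - ((k - p : ℕ) : ℝ)) / (((M + k : ℕ) : ℝ) + 2 - ((k - p : ℕ) : ℝ)) = node M p := by
  rw [Nat.cast_sub hp.le, node]
  push_cast
  congr 1 <;> ring

theorem sum_Icc_eq_sum_range (k : ℕ) (f : ℕ → ℝ) :
    ∑ i ∈ Finset.Icc 1 k, f i = ∑ p ∈ Finset.range k, f (k - p) := by
  refine Finset.sum_nbij' (fun i => k - i) (fun p => k - p) ?_ ?_ ?_ ?_ ?_ <;>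
    simp <;> intros <;> first | omega | skip
  rename_i i h1 h2
  rw [Nat.sub_sub_self h2]

/-- The survival function of `s_k` on `[0, ∞)`. -/
noncomputable def survival (M k : ℕ) (s : ℝ) : ℝ :=
  ∑ p ∈ Finset.range k, nodeCoeff (node M) M k p * (max (node M p - s) 0) ^ (M + k)

theorem pow_mul_H {b s : ℝ} (hb : 0 < b) (hs : 0 ≤ s) {n : ℕ} (hn : n ≠ 0) :
    (1 - b⁻¹ * s) ^ n * H s 0 b = (max (1 - b⁻¹ * s) 0) ^ n := by
  rcases le_or_gt s b with h | h
  · have : b⁻¹ * s ≤ 1 := by rw [inv_mul_le_iff₀ hb]; linarith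
    rw [max_eq_left (by linarith), H, Set.indicator_of_mem (Set.mem_Icc.2 ⟨hs, h⟩), mul_one]
  · have : 1 ≤ b⁻¹ * s := by rw [le_inv_mul_iff₀ hb]; linarith
    rw [max_eq_right (by linarith), H, Set.indicator_of_notMem (fun h' => h'.2.not_gt h), mul_zero,
      zero_pow hn]

theorem cdfClosed_eq {M k : ℕ} (hk : 1 ≤ k) {s : ℝ} (hs : 0 ≤ s) :
    cdfClosed k (M + k) s = 1 - survival M k s := by
  obtain ⟨K, rfl⟩ : ∃ K, k = K + 1 := ⟨k - 1, by omega⟩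
  -- Expanding the constant `1` over the nodes lets the two sides be compared summand by summand.
  rw [← sum_nodeCoeff_mul_pow (node_strictMono M) (node_pos M) M K, survival,
    ← Finset.sum_sub_distrib, cdfClosed, sum_Icc_eq_sum_range, Finset.mul_sum]
  refine Finset.sum_congr rfl fun p hp => ?_
  have hp : p < K + 1 := Finset.mem_range.1 hp
  rw [← inv_div ((((K + 1 : ℕ)) : ℝ) + 1 - _), mul_div_assoc, endpoint_eq hp,
    pow_mul_H (node_pos M p) hs (by omega), ← mul_assoc, ← mul_assoc, coeff_eq_nodeCoeff hp]
  have hb := node_pos M p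
  have : max (node M p - s) 0 = node M p * max (1 - (node M p)⁻¹ * s) 0 := by
    rw [mul_max_of_nonneg _ _ hb.le, mul_zero, mul_sub, mul_inv_cancel_left₀ hb.ne', mul_one]
  rw [this, mul_pow]
  ring_nf

/-! ### The density and its integrals -/

theorem integral_one_sub_inv_mul_pow (b m : ℝ) (hb : b ≠ 0) {n : ℕ} (hn : n ≠ 0) :
    ∫ x in (0:ℝ)..m, (1 - b⁻¹ * x) ^ (n - 1) = b / n * (1 - (1 - b⁻¹ * m) ^ n) := by
  obtain ⟨n, rfl⟩ := Nat.exists_eq_succ_of_ne_zero hn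
  rw [intervalIntegral.integral_comp_sub_mul (fun x => x ^ (n.succ - 1)) (inv_ne_zero hb) 1,
    integral_pow]
  simp only [Nat.succ_eq_add_one, Nat.add_sub_cancel]
  push_cast
  simp
  field_simp

theorem endpoint_pos {k N i : ℕ} (hkN : k ≤ N) (hi : i ∈ Finset.Icc 1 k) :
    0 < ((k : ℝ) + 1 - i) / ((N : ℝ) + 2 - i) := by
  have h1 : (i : ℝ) ≤ k := by exact_mod_cast (Finset.mem_Icc.1 hi).2
  have h2 : (k : ℝ) ≤ N := by exact_mod_cast hkN
  exact div_pos (by linarith) (by linarith)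

theorem cdfIntegral_eq_cdfClosed {k N : ℕ} (hN : N ≠ 0) (hkN : k ≤ N) {s : ℝ} (hs : 0 ≤ s) :
    cdfIntegral k N s = cdfClosed k N s := by
  rw [cdfIntegral, cdfClosed, div_mul_eq_mul_div, mul_div_assoc, Finset.sum_div]
  congr 1
  refine Finset.sum_congr rfl fun i hi => ?_
  have hb := endpoint_pos hkN hi
  rw [← inv_div ((k : ℝ) + 1 - i), mul_div_assoc (coeffa i k)]
  set b := ((k : ℝ) + 1 - i) / ((N : ℝ) + 2 - i)
  rw [intervalIntegral.integral_const_mul, integral_one_sub_inv_mul_pow b _ hb.ne' hN,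
    pow_mul_H hb hs hN]
  have : max (1 - b⁻¹ * s) 0 = 1 - b⁻¹ * min s b := by
    rcases le_total s b with h | h
    · have : b⁻¹ * s ≤ 1 := by rw [inv_mul_le_iff₀ hb]; linarith
      rw [min_eq_left h, max_eq_left (by linarith)]
    · have : 1 ≤ b⁻¹ * s := by rw [le_inv_mul_iff₀ hb]; linarith
      rw [min_eq_right h, max_eq_right (by linarith), inv_mul_cancel₀ hb.ne', sub_self]
  rw [this]
  ring

/-- A single summand of the density. -/
noncomputable def densityTerm (k N i : ℕ) : ℝ → ℝ :=
  (Set.Icc 0 (((k : ℝ) + 1 - i) / ((N : ℝ) + 2 - i))).indicator fun s =>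
    coeffa i k * (1 - (((N : ℝ) + 2 - i) / ((k : ℝ) + 1 - i)) * s) ^ (N - 1)

theorem density_eq (k N : ℕ) (s : ℝ) :
    density k N s = coeffA k N * ∑ i ∈ Finset.Icc 1 k, densityTerm k N i s := by
  rw [density]
  congr 1
  refine Finset.sum_congr rfl fun i _ => ?_
  rw [densityTerm, H, Set.indicator_apply, Set.indicator_apply]
  split_ifs <;> simp

theorem integrable_densityTerm (k N i : ℕ) : Integrable (densityTerm k N i) := by
  rw [densityTerm, integrable_indicator_iff measurableSet_Icc]
  exact Continuous.integrableOn_Icc (by fun_prop)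

theorem integrable_density (k N : ℕ) : Integrable (density k N) := by
  rw [funext (density_eq k N)]
  exact (integrable_finsetSum _ fun i _ => integrable_densityTerm k N i).const_mul _

theorem density_of_neg (k N : ℕ) {s : ℝ} (hs : s < 0) : density k N s = 0 := by
  rw [density_eq, Finset.sum_eq_zero, mul_zero]
  exact fun i _ => Set.indicator_of_notMem (fun h => h.1.not_gt hs) _

theorem integral_density {k N : ℕ} (hkN : k ≤ N) {s : ℝ} (hs : 0 ≤ s) :
    ∫ x in (0:ℝ)..s, density k N x = cdfIntegral k N s := by
  simp only [density_eq]
  rw [cdfIntegral, intervalIntegral.integral_const_mul, intervalIntegral.integral_finsetSum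
    fun i _ => (integrable_densityTerm k N i).intervalIntegrable]
  congr 1
  refine Finset.sum_congr rfl fun i hi => ?_
  have hb := endpoint_pos hkN hi
  rw [intervalIntegral.integral_of_le hs, intervalIntegral.integral_of_le (le_min hs hb.le),
    ← integral_Icc_eq_integral_Ioc, ← integral_Icc_eq_integral_Ioc, densityTerm,
    setIntegral_indicator measurableSet_Icc, Set.Icc_inter_Icc, sup_idem]

/-- For `N ≥ 2` the density is continuous on `[0, ∞)`, hence at every point there it is the
derivative of its monotone integral. -/
theorem density_nonneg_of_monotoneOn {k N : ℕ} (hk : 1 ≤ k) (hkN : k ≤ N)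
    (hmono : MonotoneOn (fun s => cdfIntegral k N s) (Set.Ici 0)) (s : ℝ) :
    0 ≤ density k N s := by
  rcases lt_or_ge s 0 with hs | hs
  · exact (density_of_neg k N hs).ge
  obtain rfl | hN : N = 1 ∨ 2 ≤ N := by omega
  -- For `N = 1` the exponent `N - 1` is `0` and the density jumps at its right endpoint, so it is
  -- checked directly.
  · obtain rfl : k = 1 := by omega
    simp only [density, coeffA, coeffa, Finset.Icc_self, Finset.sum_singleton, Nat.sub_self,
      pow_zero, mul_one, H]
    refine mul_nonneg (by norm_num) (mul_nonneg (by norm_num) ?_)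
    exact Set.indicator_nonneg (fun _ _ => zero_le_one) _
  · let g : ℝ → ℝ := fun x => coeffA k N * ∑ i ∈ Finset.Icc 1 k, coeffa i k *
      (max (1 - (((k : ℝ) + 1 - i) / ((N : ℝ) + 2 - i))⁻¹ * x) 0) ^ (N - 1)
    have hg : Continuous g := by fun_prop
    have hdg : ∀ x, 0 ≤ x → density k N x = g x := fun x hx => by
      simp only [density, g]
      congr 1
      refine Finset.sum_congr rfl fun i hi => ?_
      rw [← inv_div ((k : ℝ) + 1 - i), mul_assoc, pow_mul_H (endpoint_pos hkN hi) hx (by omega)]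
    have hcdf : ∀ x ∈ Set.Ici (0:ℝ), ∫ t in (0:ℝ)..x, g t = cdfIntegral k N x := fun x hx => by
      rw [← integral_density hkN hx]
      refine intervalIntegral.integral_congr fun t ht => ?_
      rw [Set.uIcc_of_le hx] at ht
      exact (hdg t ht.1).symm
    have hder : HasDerivWithinAt (fun x => ∫ t in (0:ℝ)..x, g t) (g s) (Set.Ici 0) s :=
      (hg.integral_hasStrictDerivAt 0 s).hasDerivAt.hasDerivWithinAt
    have hmono' : MonotoneOn (fun x => ∫ t in (0:ℝ)..x, g t) (Set.Ici 0) :=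
      hmono.congr fun x hx => (hcdf x hx).symm
    rw [hdg s hs, ← hder.derivWithin (uniqueDiffOn_Ici 0 s hs)]
    exact hmono'.derivWithin_nonneg

/-! ### The distribution of the sum of the smallest spacings -/

theorem volume_real_simplex (N : ℕ) : volume.real (simplex N) = 1 / N ! := by
  have : simplex N = slab 0 1 (-1) := by ext d; simp [simplex, slab]
  rw [this, volume_real_slab_of_neg 0 (fun _ => le_rfl) zero_le_one (by norm_num), one_pow]

theorem measureReal_lt_sumSmallest {Ω : Type*} [MeasurableSpace Ω] (P : Measure Ω)
    [IsProbabilityMeasure P] {N k : ℕ} (hkN : k ≤ N) (X : Fin N → Ω → ℝ)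
    (hX : ∀ j, Measurable (X j))
    (hunif : ∀ j, pdf.IsUniform (X j) (Set.Icc (0 : ℝ) 1) P volume) (hindep : iIndepFun X P)
    (s : ℝ) :
    P.real {ω | s < sumSmallest k fun j => X j ω} =
      N ! * volume.real (slab (weight k N) 1 s) := by
  obtain ⟨c, hc⟩ := exists_measure_normalizedDiff_eq_mul P X hX hunif hindep
  -- Total mass `1` against the simplex volume `1 / N!` determines the constant.
  have hcN : c.toReal = N ! := by
    have h := congrArg ENNReal.toReal (hc Set.univ .univ)
    have h' := volume_real_simplex N
    rw [measureReal_def] at h'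
    rw [Set.inter_univ, ENNReal.toReal_mul, h'] at h
    have hN : (N ! : ℝ) ≠ 0 := by positivity
    simp at h
    field_simp at h
    exact h.symm
  have hB : MeasurableSet {d : Fin N → ℝ | s < ∑ j, weight k N j * d j} :=
    measurableSet_lt (by fun_prop) (by fun_prop)
  have h := congrArg ENNReal.toReal (hc _ hB)
  rw [ENNReal.toReal_mul, hcN] at h
  simp only [sumSmallest_eq hkN]
  refine h.trans ?_
  congr 3
  ext d
  simp [simplex, slab, and_assoc]

theorem measureReal_sumSmallest_le {Ω : Type*} [MeasurableSpace Ω] (P : Measure Ω)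
    [IsProbabilityMeasure P] {N k : ℕ} (hkN : k ≤ N) (X : Fin N → Ω → ℝ)
    (hX : ∀ j, Measurable (X j))
    (hunif : ∀ j, pdf.IsUniform (X j) (Set.Icc (0 : ℝ) 1) P volume) (hindep : iIndepFun X P)
    (s : ℝ) :
    P.real {ω | sumSmallest k (fun j => X j ω) ≤ s} =
      1 - N ! * volume.real (slab (weight k N) 1 s) := by
  rw [← measureReal_lt_sumSmallest P hkN X hX hunif hindep s, ← probReal_compl_eq_one_sub]
  · congr 1; ext ω; simp
  · exact measurableSet_lt measurable_const
      ((measurable_sumSmallest k).comp (measurable_pi_lambda _ hX))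

theorem measureReal_sumSmallest_le_eq_cdfClosed {Ω : Type*} [MeasurableSpace Ω] (P : Measure Ω)
    [IsProbabilityMeasure P] {N k : ℕ} (hk : 1 ≤ k) (hkN : k ≤ N) (X : Fin N → Ω → ℝ)
    (hX : ∀ j, Measurable (X j))
    (hunif : ∀ j, pdf.IsUniform (X j) (Set.Icc (0 : ℝ) 1) P volume) (hindep : iIndepFun X P)
    {s : ℝ} (hs : 0 ≤ s) :
    P.real {ω | sumSmallest k (fun j => X j ω) ≤ s} = cdfClosed k N s := by
  rw [measureReal_sumSmallest_le P hkN X hX hunif hindep]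
  obtain ⟨M, rfl⟩ : ∃ M, N = M + k := ⟨N - k, by omega⟩
  rw [cdfClosed_eq hk hs, weight_eq_slabWeight,
    volume_real_slab_slabWeight (node_strictMono M) (node_pos M) M k zero_le_one hs, survival,
    Finset.mul_sum]
  congr 1
  refine Finset.sum_congr rfl fun p _ => ?_
  have : ((M + k)! : ℝ) ≠ 0 := by positivity
  rw [mul_one]
  field_simp

theorem measureReal_sumSmallest_le_of_neg {Ω : Type*} [MeasurableSpace Ω] (P : Measure Ω)
    [IsProbabilityMeasure P] {N k : ℕ} (hkN : k ≤ N) (X : Fin N → Ω → ℝ)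
    (hX : ∀ j, Measurable (X j))
    (hunif : ∀ j, pdf.IsUniform (X j) (Set.Icc (0 : ℝ) 1) P volume) (hindep : iIndepFun X P)
    {s : ℝ} (hs : s < 0) :
    P.real {ω | sumSmallest k (fun j => X j ω) ≤ s} = 0 := by
  rw [measureReal_sumSmallest_le P hkN X hX hunif hindep, volume_real_slab_of_neg _ (fun j => ?_)
    zero_le_one hs]
  · have : (N ! : ℝ) ≠ 0 := by positivity
    rw [one_pow]; field_simp; simp
  · have : (j : ℝ) < N := by exact_mod_cast j.isLt
    exact div_nonneg (Nat.cast_nonneg _) (by linarith)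

/-- The two measures agree on half-lines; `hnonneg` makes the lower integral of `ENNReal.ofReal` of
the density equal to its ordinary integral. -/
theorem map_sumSmallest_eq_withDensity {Ω : Type*} [MeasurableSpace Ω] (P : Measure Ω)
    [IsProbabilityMeasure P] {N k : ℕ} (hk : 1 ≤ k) (hkN : k ≤ N) (X : Fin N → Ω → ℝ)
    (hX : ∀ j, Measurable (X j))
    (hunif : ∀ j, pdf.IsUniform (X j) (Set.Icc (0 : ℝ) 1) P volume) (hindep : iIndepFun X P)
    (hnonneg : ∀ s, 0 ≤ density k N s) :
    P.map (fun ω => sumSmallest k fun j => X j ω) =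
      volume.withDensity fun s => ENNReal.ofReal (density k N s) := by
  have hmeas : Measurable fun ω => sumSmallest k fun j => X j ω :=
    (measurable_sumSmallest k).comp (measurable_pi_lambda _ hX)
  have : IsProbabilityMeasure (P.map fun ω => sumSmallest k fun j => X j ω) :=
    Measure.isProbabilityMeasure_map hmeas.aemeasurable
  refine Measure.ext_of_Iic _ _ fun a => ?_
  rw [Measure.map_apply hmeas measurableSet_Iic, withDensity_apply _ measurableSet_Iic,
    ← ofReal_integral_eq_lintegral_ofReal (integrable_density k N).integrableOn
      (Filter.Eventually.of_forall hnonneg), ← ofReal_measureReal]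
  congr 1
  change P.real {ω | sumSmallest k (fun j => X j ω) ≤ a} = _
  rcases lt_or_ge a 0 with ha | ha
  · rw [measureReal_sumSmallest_le_of_neg P hkN X hX hunif hindep ha,
      setIntegral_eq_zero_of_forall_eq_zero fun x (hx : x ∈ Set.Iic a) =>
        density_of_neg k N (lt_of_le_of_lt hx ha)]
  · rw [measureReal_sumSmallest_le_eq_cdfClosed P hk hkN X hX hunif hindep ha,
      ← cdfIntegral_eq_cdfClosed (by omega) hkN ha, ← integral_density hkN ha,
      intervalIntegral.integral_of_le ha, ← integral_Icc_eq_integral_Ioc]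
    refine setIntegral_eq_of_subset_of_forall_sdiff_eq_zero measurableSet_Iic
      (fun x hx => hx.2) (fun x hx => density_of_neg k N ?_) |>.symm
    exact not_le.1 fun h => hx.2 ⟨h, hx.1⟩

end UniformSpacings

theorem mainTheorem1 {Ω : Type*} [MeasurableSpace Ω] (P : Measure Ω) [IsProbabilityMeasure P]
    (N k : ℕ) (hk : 1 ≤ k) (hkN : k ≤ N)
    (X : Fin N → Ω → ℝ)
    (hX : ∀ j, Measurable (X j))
    (hunif : ∀ j, pdf.IsUniform (X j) (Set.Icc (0 : ℝ) 1) P volume)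
    (hindep : iIndepFun X P) :
    -- the law of `s_k` is absolutely continuous, with the stated (nonnegative) density
    ((∀ s : ℝ, 0 ≤ UniformSpacings.density k N s) ∧
      AEMeasurable (fun ω => UniformSpacings.sumSmallest k (fun j => X j ω)) P ∧
      P.map (fun ω => UniformSpacings.sumSmallest k (fun j => X j ω)) =
        volume.withDensity (fun s => ENNReal.ofReal (UniformSpacings.density k N s))) ∧
    -- both forms of the distribution function on `[0, ∞)`, and its value below `0`
    (∀ s : ℝ, 0 ≤ s →
      P.real {ω | UniformSpacings.sumSmallest k (fun j => X j ω) ≤ s} =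
          UniformSpacings.cdfIntegral k N s ∧
        UniformSpacings.cdfIntegral k N s = UniformSpacings.cdfClosed k N s) ∧
    (∀ s : ℝ, s < 0 →
      P.real {ω | UniformSpacings.sumSmallest k (fun j => X j ω) ≤ s} = 0) := by
  have hclosed : ∀ s : ℝ, 0 ≤ s →
      UniformSpacings.cdfIntegral k N s = UniformSpacings.cdfClosed k N s := fun s hs =>
    UniformSpacings.cdfIntegral_eq_cdfClosed (by omega) hkN hs
  have hcdf : ∀ s : ℝ, 0 ≤ s → P.real {ω | UniformSpacings.sumSmallest k (fun j => X j ω) ≤ s} =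
      UniformSpacings.cdfIntegral k N s := fun s hs => by
    rw [hclosed s hs]
    exact UniformSpacings.measureReal_sumSmallest_le_eq_cdfClosed P hk hkN X hX hunif hindep hs
  -- Monotonicity is read off from the probabilities, not from the alternating formula.
  have hnonneg := UniformSpacings.density_nonneg_of_monotoneOn hk hkN fun s hs t ht hst => by
    change UniformSpacings.cdfIntegral k N s ≤ UniformSpacings.cdfIntegral k N t
    rw [← hcdf s hs, ← hcdf t ht]
    exact measureReal_mono fun ω hω => le_trans hω hst
  exact ⟨⟨hnonneg, ((UniformSpacings.measurable_sumSmallest k).comp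
      (measurable_pi_lambda _ hX)).aemeasurable,
    UniformSpacings.map_sumSmallest_eq_withDensity P hk hkN X hX hunif hindep hnonneg⟩,
    fun s hs => ⟨hcdf s hs, hclosed s hs⟩,
    fun s hs => UniformSpacings.measureReal_sumSmallest_le_of_neg P hkN X hX hunif hindep hs⟩
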